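/- Setting. Let $\mathbb F/\mathbb E$ and $\mathbb K/\mathbb E$ be finite field extensions inside a common field, with $\mathbb F\cap\mathbb K=\mathbb E$, $\mathbb L=\mathbb F\mathbb K$ and $[\mathbb F:\mathbb E]=[\mathbb L:\mathbb K]=m$, where $\mathbb L/\mathbb K$ is a cyclic Galois extension. Let $\sigma\in\mathrm{Gal}(\mathbb L/\mathbb K)$ restrict to an automorphism $\theta$ of $\mathbb F$ of order $m$ with fixed field $\mathbb E$. Let $\ell\ge 1$ be coprime to $m$, and assume that $\mathbb K$ contains a primitive $\ell$-th root of unity. Put $n=m\ell$ and write $c\in\mathbb F^{n}$ as $c=(c^{(0)}\mid\dots\mid c^{(\ell-1)})$ with $c^{(i)}=(c^{(i)}_0,\dots,c^{(i)}_{m-1})\in\mathbb F^m$. The sum-rank weight of $c$ is $\sum_{i=0}^{\ell-1}\dim_{\mathbb E}\langle c^{(i)}_0,\dots,c^{(i)}_{m-1}\rangle_{\mathbb E}$, and the minimum sum-rank distance $d_{\mathrm{SR}}(\mathcal C)$ of an $\mathbb F$-linear code $\mathcal C\subseteq\mathbb F^n$ is the minimum of the sum-rank weights of its nonzero codewords ($+\infty$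 if $\mathcal C=0$). The code $\mathcal C$ is cyclic-skew-cyclic if it is stable under $(c^{(0)}\mid\dots\mid c^{(\ell-1)})\mapsto(c^{(\ell-1)}\mid c^{(0)}\mid\dots\mid c^{(\ell-2)})$ and under the map that replaces every block $(v_0,\dots,v_{m-1})$ by $(\theta(v_{m-1}),\theta(v_0),\dots,\theta(v_{m-2}))$. Let $\mathcal S'=\mathbb F[x]/(x^\ell-1)$, extend $\theta$ to $\mathcal S'$ by $\theta(x)=x$, let $\mathcal S'[z;\theta]$ be the skew polynomial ring with $zf=\theta(f)z$, and let $\mathcal R'=\mathcal S'[z;\theta]/(z^m-1)$. Identify $\mathbb F^n$ with $\mathcal R'$ through $\nu(c)=\sum_{j=0}^{m-1}\bigl(\sum_{i=0}^{\ell-1}c^{(i)}_jx^i\bigr)z^j$. A generator of $\mathcal C$ is a skew polynomial $g\in\mathcal S'[z;\theta]$ whose class generates the left ideal $\nu(\mathcal C)$ of $\mathcal R'$ (one exists, since $\ell$ is invertible in $\mathbb F$). For $\alpha\in\mathbb K$ with $\alpha^\ell=1$, $\gamma\in\mathbb L^*$ and $g=\sum_j g_j(x)z^j$, let $\mathrm{Ev}_{\alpha,\gamma}(g)$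 be the remainder of $\sum_j g_j(\alpha)z^j\in\mathbb L[z;\sigma]$ on right division by $z-\sigma(\gamma)\gamma^{-1}$. The defining set of $\mathcal C$ is $$T_{\mathcal C}=\{(\alpha,\gamma)\in\mathbb K\times\mathbb L^*:\ \alpha^\ell=1,\ \mathrm{Ev}_{\alpha,\gamma}(g)=0\},$$ which does not depend on the choice of the generator $g$ of $\mathcal C$. Theorem (sum-rank Roos bound). Let $\mathcal C\subseteq\mathbb F^n$ be a cyclic-skew-cyclic code, let $a\in\mathbb K$ be a primitive $\ell$-th root of unity, and let $\beta$ be a normal element of $\mathbb L/\mathbb K$. Let $r\ge 0$ and let $b,s,\delta,k_0,\dots,k_r$ be integers such that $\gcd(n,s)=1$, $k_0<k_1<\dots<k_r$ and $k_r-k_0\le\delta+r-2$ (so that $\delta\ge 2$). If $$\{(a^{b+si+k_j},\sigma^{si+k_j}(\beta)):\ 0\le i\le\delta-2,\ 0\le j\le r\}\subseteq T_{\mathcal C},$$ then $d_{\mathrm{SR}}(\mathcal C)\ge\delta+r$. -/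

import Mathlib

noncomputable section

namespace SumRank

section Metric

variable (E : Type*) {F : Type*} [Field E] [Field F] [Algebra E F] {ℓ m : ℕ}

/-- Rank weight over `F/E`: the `E`-dimension of the span of the coordinates. -/
def rankWeight {N : ℕ} (v : Fin N → F) : ℕ :=
  Module.finrank E (Submodule.span E (Set.range v))

/-- Sum-rank weight of `c = (c⁽⁰⁾ | … | c⁽ℓ⁻¹⁾)`, for the partition of `n = m ℓ` into `ℓ` blocks
of length `m`; the block `c⁽ⁱ⁾` is `c i`. -/
def sumRankWeight (c : Fin ℓ → Fin m → F) : ℕ := ∑ i, rankWeight E (c i)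

/-- Minimum sum-rank distance of a linear code: the minimum of the weights of its nonzero
codewords (`⊤` for the zero code, which has none). -/
def minDist (C : Submodule F (Fin ℓ → Fin m → F)) : ℕ∞ :=
  ⨅ c ∈ C, ⨅ _ : c ≠ 0, (sumRankWeight E c : ℕ∞)

end Metric

section Shifts

variable {F : Type*} [Field F] {ℓ m : ℕ} [NeZero ℓ] [NeZero m]

/-- The block shift `(c⁽⁰⁾ | … | c⁽ℓ⁻¹⁾) ↦ (c⁽ℓ⁻¹⁾ | c⁽⁰⁾ | … | c⁽ℓ⁻²⁾)`;
indices are subtracted cyclically in `Fin ℓ`. -/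
def blockShift (c : Fin ℓ → Fin m → F) : Fin ℓ → Fin m → F := fun i => c (i - 1)

/-- The `θ`-inblock shift: every block `(v₀, …, v_{m-1})` is replaced by
`(θ v_{m-1}, θ v₀, …, θ v_{m-2})`. -/
def inblockShift (θ : F →+* F) (c : Fin ℓ → Fin m → F) : Fin ℓ → Fin m → F :=
  fun i j => θ (c i (j - 1))

/-- Cyclic-skew-cyclic codes: stable under the block shift and the `θ`-inblock shift. -/
def IsCyclicSkewCyclic (θ : F →+* F) (C : Submodule F (Fin ℓ → Fin m → F)) : Prop :=
  (∀ c ∈ C, blockShift c ∈ C) ∧ (∀ c ∈ C, inblockShift θ c ∈ C)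

end Shifts

section SkewPolynomials

/-- A copy of the ring `R` on which `1 : ℕ` acts by the endomorphism `φ`. -/
def Twist {R : Type*} [CommRing R] (_φ : R →+* R) : Type _ := R

variable {R : Type*} [CommRing R] (φ : R →+* R)

instance : CommRing (Twist φ) := inferInstanceAs (CommRing R)

instance : MulSemiringAction (Multiplicative ℕ) (Twist φ) :=
  MulSemiringAction.compHom R (powersHom (R →+* R) φ)

/-- The element of `Twist φ` given by an element of `R`. -/
def toTwist : R ≃+* Twist φ := RingEquiv.refl R

/-- The skew polynomial ring `R[z; φ]`, in which `z a = φ(a) z`. -/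
abbrev SkewPoly := SkewPolynomial (Twist φ)

/-- The quotient `R[z; φ] / (z ^ N - 1)` by a two-sided ideal. -/
abbrev SkewPolyMod (N : ℕ) :=
  (TwoSidedIdeal.span {(SkewPolynomial.X : SkewPoly φ) ^ N - 1}).ringCon.Quotient

/-- The class in `R[z; φ] / (z ^ N - 1)` of a skew polynomial. -/
def skewMk (N : ℕ) : SkewPoly φ →+* SkewPolyMod φ N :=
  (TwoSidedIdeal.span {(SkewPolynomial.X : SkewPoly φ) ^ N - 1}).ringCon.mk'

/-- Defining relation of the skew polynomial ring. -/
theorem skewX_mul_C (a : R) :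
    (SkewPolynomial.X : SkewPoly φ) * SkewPolynomial.C (toTwist φ a) =
      SkewPolynomial.C (toTwist φ (φ a)) * SkewPolynomial.X := by
  simp only [SkewPolynomial.X, SkewPolynomial.monomial_mul_C, SkewPolynomial.C_mul_monomial,
    one_mul, mul_one, Function.iterate_one]
  rfl

end SkewPolynomials

section Evaluation

variable {F : Type*} [Field F]

/-- The commutative ring `S' = F[x] / (x ^ ℓ - 1)`. -/
abbrev CycRing (F : Type*) [Field F] (ℓ : ℕ) :=
  AdjoinRoot ((Polynomial.X : Polynomial F) ^ ℓ - 1)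

/-- The extension of `θ` to `S' = F[x] / (x ^ ℓ - 1)` with `θ(x) = x`. -/
def cycTheta (θ : F →+* F) (ℓ : ℕ) : CycRing F ℓ →+* CycRing F ℓ :=
  AdjoinRoot.map θ _ _ (by simp)

/-- The map `ν` from `F ^ (m ℓ)` to `R' = S'[z; θ] / (z ^ m - 1)`,
`c ↦ ∑ j, (∑ i, c⁽ⁱ⁾ⱼ x ^ i) z ^ j`. -/
def nu {ℓ m : ℕ} (θ : F →+* F) (c : Fin ℓ → Fin m → F) : SkewPolyMod (cycTheta θ ℓ) m :=
  skewMk (cycTheta θ ℓ) m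
    (∑ j : Fin m, SkewPolynomial.monomial (j : ℕ) (toTwist (cycTheta θ ℓ)
      (∑ i : Fin ℓ, AdjoinRoot.of _ (c i j) * AdjoinRoot.root _ ^ (i : ℕ))))

/-- `g ∈ S'[z; θ]` is a generator skew polynomial of the code `C`: the image of `C` in `R'` is the
left ideal generated by the class of `g`. -/
def IsGenerator {ℓ m : ℕ} (θ : F →+* F) (C : Submodule F (Fin ℓ → Fin m → F))
    (g : SkewPoly (cycTheta θ ℓ)) : Prop :=
  nu θ '' (C : Set (Fin ℓ → Fin m → F)) =
    (Ideal.span {skewMk (cycTheta θ ℓ) m g} : Ideal (SkewPolyMod (cycTheta θ ℓ) m))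

variable {K L : Type*} [Field K] [Field L] [Algebra F L] [Algebra K L] {ℓ : ℕ}

/-- Evaluation `S' → L`, `f ↦ f(a)`, at an `ℓ`-th root of unity `a ∈ K`. -/
def cycEval (F L : Type*) [Field F] [Field L] [Algebra F L] [Algebra K L]
    (a : K) (ha : a ^ ℓ = 1) : CycRing F ℓ →+* L :=
  AdjoinRoot.lift (algebraMap F L) (algebraMap K L a) (by simp [← map_pow, ha])

/-- The map `Ev_{a,z}`: `∑ j, f_j(x) z ^ j ↦ ∑ j, f_j(a) z ^ j`. -/
def evX (θ : F →+* F) (σ : L →+* L) (a : K) (ha : a ^ ℓ = 1)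
    (f : SkewPoly (cycTheta θ ℓ)) : SkewPoly σ :=
  f.sum fun j p =>
    SkewPolynomial.monomial j (toTwist σ (cycEval F L a ha ((toTwist (cycTheta θ ℓ)).symm p)))

/-- The left ideal of `L[z; σ]` generated by `z - σ(β) β⁻¹`. Mathlib's `Ideal` means left ideal. -/
def rootIdeal (σ : L →+* L) (β : L) : Ideal (SkewPoly σ) :=
  Ideal.span {SkewPolynomial.X - SkewPolynomial.C (toTwist σ (σ β * β⁻¹))}

/-- The total evaluation `Ev_{a,β}(f)`: the class of `f(a, z)` modulo the left ideal generated by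
`z - σ(β) β⁻¹`. The quotient is identified with `L` by the remainder of right division. -/
def totalEval (θ : F →+* F) (σ : L →+* L) (a : K) (ha : a ^ ℓ = 1) (β : L)
    (f : SkewPoly (cycTheta θ ℓ)) : SkewPoly σ ⧸ rootIdeal σ β :=
  Submodule.Quotient.mk (evX θ σ a ha f)

/-- The defining set of a code: the pairs `(a, β)`, with `a ^ ℓ = 1` and `β ≠ 0`, at which its
generator skew polynomial vanishes. (Generators of the same left ideal have the same zeros.) -/
def definingSet {m : ℕ} (θ : F →+* F) (σ : L →+* L) (C : Submodule F (Fin ℓ → Fin m → F)) :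
    Set (K × L) :=
  {p | p.2 ≠ 0 ∧ ∃ ha : p.1 ^ ℓ = 1,
    ∃ g : SkewPoly (cycTheta θ ℓ), IsGenerator θ C g ∧ totalEval θ σ p.1 ha p.2 g = 0}

end Evaluation

/-- `β` is a normal element of `L/K`: its conjugates form a `K`-basis of `L`. -/
def IsNormalElement (K : Type*) {L : Type*} [Field K] [Field L] [Algebra K L] (β : L) : Prop :=
  LinearIndependent K (fun τ : L ≃ₐ[K] L => τ β) ∧
    Submodule.span K (Set.range fun τ : L ≃ₐ[K] L => τ β) = ⊤

end SumRank

end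

/-!
# The sum-rank Roos bound

A skew polynomial `∑ j, f_j(x) z ^ j` acts on `L` as the additive operator `∑ j, f_j(α) σ^j`. This
is a ring action of `S'[z; θ]`, it kills `z ^ m - 1` because `σ ^ m = 1`, and `Ev_{α,γ}(f) = 0` says
that `f` sends `γ` to `0`. Hence a zero `(α, γ)` of a generator gives for every codeword `c` the
parity check `∑ t, ∑ u, c_{t,u} α ^ t σ^u(γ) = 0` (`sum_eq_zero_of_mem_definingSet`).

Factor each block as `c^(t) = x^(t) A^(t)` with `A^(t)` over `E` of full row rank
(`exists_rank_factorization`). As `β` is normal, the entries `y_{t,v} = ∑ u, A^(t)_{v,u} σ^u(β)` of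
each block are independent over `K`, and the parity checks at `(a ^ (b + e), σ^e(β))` become
`∑ x_{t,v} a ^ (b t) (P_e)_{t,v} = 0` with `P_e = (a ^ (t e) σ^e(y_{t,v}))`, a vector of length the
sum-rank weight `w` of `c`. So if the vectors `P_{s i + k_j}` span `L ^ w`, then `c = 0`.

For `s` prime to `m ℓ` the only subspace that contains some `P_e` and is stable under the
semilinear map `P_e ↦ P_{e + s}` is `L ^ w` (`eq_top_of_orbitVec_mem`), so that sums of translates
gain a dimension at each step until they fill the space (`min_finrank_le_finrank_iterSpan`). With
shift `1`, the `δ + r - 1` consecutive vectors from `P_{k_0}` on span `L ^ w` when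
`w ≤ δ + r - 1`; all but `δ - 2` of them are among the `P_{k_j}`, whose span therefore has dimension
at least `w - (δ - 2)`. Its `δ - 2` translates by multiples of `s` supply the missing dimensions
(`iterSpan_eq_top_of_roos`).
-/

namespace SumRank

/-! ### The action of skew polynomials on the field -/

section SkewAction

variable {R L : Type*} [CommRing R] [Field L]

/-- The action of `R[z; φ]` on `L` through `ε : R → L` and `σ : L → L` with `ε ∘ φ = σ ∘ ε`:
the skew polynomial `∑ j, r_j z ^ j` acts as the additive map `x ↦ ∑ j, ε(r_j) σ^j(x)`. -/
noncomputable def skewAction (φ : R →+* R) (ε : R →+* L) (σ : L →+* L)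
    (h : ∀ r, ε (φ r) = σ (ε r)) : SkewPoly φ →+* AddMonoid.End L :=
  SkewMonoidAlgebra.liftNCRingHom
    ((Module.toAddMonoidEnd L L).comp (ε.comp ((toTwist φ).symm : Twist φ →+* R)))
    (powersHom (AddMonoid.End L) (σ : L →+ L)) (by
      intro x n
      have key : ∀ j : ℕ, ∀ r : R, ε ((φ ^ j) r) = (σ^[j]) (ε r) := by
        intro j
        induction j with
        | zero => intro r; rfl
        | succ j ih => intro r; rw [pow_succ, Function.iterate_succ, Function.comp, ← h, ← ih]; rfl
      ext y
      change ε ((φ ^ n.toAdd) ((toTwist φ).symm x)) * (powersHom (AddMonoid.End L) (σ : L →+ L) n) y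
        = (powersHom (AddMonoid.End L) (σ : L →+ L) n) (ε ((toTwist φ).symm x) * y)
      erw [AddMonoid.End.coe_pow]
      rw [key]
      exact (iterate_map_mul σ _ _ _).symm)

theorem skewAction_monomial (φ : R →+* R) (ε : R →+* L) (σ : L →+* L)
    (h : ∀ r, ε (φ r) = σ (ε r)) (j : ℕ) (r : R) (x : L) :
    skewAction φ ε σ h (SkewPolynomial.monomial j (toTwist φ r)) x = ε r * (σ^[j]) x := by
  have := SkewMonoidAlgebra.liftNC_single
    (((Module.toAddMonoidEnd L L).comp (ε.comp ((toTwist φ).symm : Twist φ →+* R)) :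
      Twist φ →+* AddMonoid.End L) : Twist φ →+ AddMonoid.End L)
    (powersHom (AddMonoid.End L) (σ : L →+ L)) (Multiplicative.ofAdd j) (toTwist φ r)
  refine (DFunLike.congr_fun this x).trans ?_
  exact congrArg (fun f : L → L => ε r * f x) (AddMonoid.End.coe_pow (M := L) (σ : L →+ L) j)

/-- `z ^ N - 1` acts as `σ ^ N - 1`, so the action factors through `R[z; φ] / (z ^ N - 1)` as soon
as `σ ^ N = 1`. -/
theorem skewAction_eq_of_skewMk_eq (φ : R →+* R) (ε : R →+* L) (σ : L →+* L)
    (h : ∀ r, ε (φ r) = σ (ε r)) {N : ℕ} (hN : ∀ x, (σ^[N]) x = x) {f g : SkewPoly φ}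
    (hfg : skewMk φ N f = skewMk φ N g) : skewAction φ ε σ h f = skewAction φ ε σ h g := by
  have hle : TwoSidedIdeal.span {(SkewPolynomial.X : SkewPoly φ) ^ N - 1} ≤
      TwoSidedIdeal.ker (skewAction φ ε σ h) := by
    rw [TwoSidedIdeal.span_le, Set.singleton_subset_iff, SetLike.mem_coe, TwoSidedIdeal.mem_ker,
      map_sub, map_one, sub_eq_zero, ← SkewPolynomial.monomial_one_right_eq_X_pow]
    ext x
    have := skewAction_monomial φ ε σ h N 1 x
    rw [map_one (toTwist φ), map_one ε, one_mul, hN] at this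
    exact this
  have hrel : (TwoSidedIdeal.span {(SkewPolynomial.X : SkewPoly φ) ^ N - 1}).ringCon f g :=
    Quotient.exact hfg
  rw [TwoSidedIdeal.rel_iff] at hrel
  have := hle hrel
  rwa [TwoSidedIdeal.mem_ker, map_sub, sub_eq_zero] at this

end SkewAction

/-! ### Parity checks from the defining set -/

section Zeros

variable {F K L : Type*} [Field F] [Field K] [Field L] [Algebra F L] [Algebra K L] {ℓ m : ℕ}

theorem cycEval_cycTheta (θ : F →+* F) (σ : L →+* L)
    (hσθ : ∀ x, algebraMap F L (θ x) = σ (algebraMap F L x))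
    (hσK : ∀ x, σ (algebraMap K L x) = algebraMap K L x) (a : K) (ha : a ^ ℓ = 1)
    (r : CycRing F ℓ) :
    cycEval F L a ha (cycTheta θ ℓ r) = σ (cycEval F L a ha r) := by
  have : (cycEval F L a ha).comp (cycTheta θ ℓ) = σ.comp (cycEval F L a ha) := by
    apply AdjoinRoot.ringHom_ext
    · ext x
      simp [cycEval, cycTheta, hσθ]
    · simp [cycEval, cycTheta, hσK]
  exact DFunLike.congr_fun this r

theorem skewAction_evX (θ : F →+* F) (σ : L →+* L) (a : K) (ha : a ^ ℓ = 1)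
    (h : ∀ r, cycEval F L a ha (cycTheta θ ℓ r) = σ (cycEval F L a ha r))
    (f : SkewPoly (cycTheta θ ℓ)) :
    skewAction σ (RingHom.id L) σ (fun _ => rfl) (evX θ σ a ha f) =
      skewAction (cycTheta θ ℓ) (cycEval F L a ha) σ h f := by
  conv_rhs => rw [← SkewPolynomial.sum_monomial f]
  rw [evX, SkewPolynomial.sum_def, SkewPolynomial.sum_def, map_sum, map_sum]
  refine Finset.sum_congr rfl fun j _ => ?_
  ext x
  rw [skewAction_monomial]
  exact (skewAction_monomial _ _ σ h j ((toTwist (cycTheta θ ℓ)).symm (f.coeff j)) x).symm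

/-- If the remainder of `f(a, z)` modulo `z - σ(γ) γ⁻¹` is zero, then `f` maps `γ` to zero: the
operator `σ - σ(γ) γ⁻¹` kills `γ`. -/
theorem skewAction_eq_zero_of_totalEval (θ : F →+* F) (σ : L →+* L) (a : K) (ha : a ^ ℓ = 1)
    (h : ∀ r, cycEval F L a ha (cycTheta θ ℓ r) = σ (cycEval F L a ha r)) {γ : L} (hγ : γ ≠ 0)
    {f : SkewPoly (cycTheta θ ℓ)} (hf : totalEval θ σ a ha γ f = 0) :
    skewAction (cycTheta θ ℓ) (cycEval F L a ha) σ h f γ = 0 := by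
  rw [← skewAction_evX]
  have hmem : evX θ σ a ha f ∈ rootIdeal σ γ := (Submodule.Quotient.mk_eq_zero _).1 hf
  obtain ⟨q, hq⟩ := Submodule.mem_span_singleton.1 hmem
  rw [← hq, smul_eq_mul, map_mul]
  change skewAction σ (RingHom.id L) σ _ q (skewAction σ (RingHom.id L) σ _ _ γ) = 0
  have h1 := skewAction_monomial σ (RingHom.id L) σ (fun _ => rfl) 1 1 γ
  have h2 := skewAction_monomial σ (RingHom.id L) σ (fun _ => rfl) 0 (σ γ * γ⁻¹) γ
  rw [map_one (toTwist σ)] at h1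
  rw [SkewPolynomial.X, ← SkewPolynomial.monomial_zero_left, map_sub]
  refine (congrArg _ ((congrArg₂ (· - ·) h1 h2 :))).trans ?_
  simp [hγ]

/-- Codewords satisfy the parity checks given by the defining set. -/
theorem sum_eq_zero_of_mem_definingSet (θ : F →+* F) (σ : L →+* L)
    (hσθ : ∀ x, algebraMap F L (θ x) = σ (algebraMap F L x))
    (hσK : ∀ x, σ (algebraMap K L x) = algebraMap K L x) (hσm : ∀ x, (σ^[m]) x = x)
    {C : Submodule F (Fin ℓ → Fin m → F)} {p : K × L} (hp : p ∈ definingSet θ σ C)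
    {c : Fin ℓ → Fin m → F} (hc : c ∈ C) :
    ∑ t, ∑ u, algebraMap F L (c t u) * algebraMap K L p.1 ^ (t : ℕ) * (σ^[(u : ℕ)]) p.2 = 0 := by
  obtain ⟨hγ, ha, g, hg, hz⟩ := hp
  have h := cycEval_cycTheta θ σ hσθ hσK p.1 ha
  have hmem : nu θ c ∈ (Ideal.span {skewMk (cycTheta θ ℓ) m g} :
      Ideal (SkewPolyMod (cycTheta θ ℓ) m)) := by
    rw [← SetLike.mem_coe, ← hg]
    exact ⟨c, hc, rfl⟩
  obtain ⟨q, hq⟩ := Submodule.mem_span_singleton.1 hmem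
  obtain ⟨q, rfl⟩ : ∃ q', skewMk (cycTheta θ ℓ) m q' = q := Quotient.exists_rep q
  rw [smul_eq_mul, ← map_mul, nu] at hq
  have key := skewAction_eq_of_skewMk_eq _ (cycEval F L p.1 ha) σ h hσm hq
  have key2 := DFunLike.congr_fun key p.2
  rw [map_mul] at key2
  replace key2 := key2.symm.trans
    (congrArg (skewAction (cycTheta θ ℓ) (cycEval F L p.1 ha) σ h q)
      (skewAction_eq_zero_of_totalEval θ σ p.1 ha h hγ hz))
  rw [map_zero, map_sum] at key2
  rw [Finset.sum_comm, ← key2]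
  refine Eq.trans ?_ (AddMonoidHom.finsetSum_apply _ _ _).symm
  refine Finset.sum_congr rfl fun u _ => ?_
  refine Eq.trans ?_ (skewAction_monomial _ _ _ h _ _ _).symm
  rw [map_sum, Finset.sum_mul]
  refine Finset.sum_congr rfl fun t _ => ?_
  simp [cycEval]

end Zeros

/-! ### Rank factorization and conjugates of independent families -/

section RankFactorization

variable (E : Type*) {F : Type*} [Field E] [Field F] [Algebra E F]

/-- Rank factorization of a vector `v` over `F/E`: with `w` its rank weight, `v = x A` for some
`x ∈ F ^ w` and a `w × N` matrix `A` over `E` that has a right inverse. -/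
theorem exists_rank_factorization {N : ℕ} (v : Fin N → F) :
    ∃ (x : Fin (rankWeight E v) → F) (A : Matrix (Fin (rankWeight E v)) (Fin N) E)
      (B : Matrix (Fin N) (Fin (rankWeight E v)) E),
      A * B = 1 ∧ ∀ u, v u = ∑ i, A i u • x i := by
  have hmem : ∀ u, v u ∈ Submodule.span E (Set.range v) := fun u =>
    Submodule.subset_span ⟨u, rfl⟩
  have : FiniteDimensional E (Submodule.span E (Set.range v)) :=
    FiniteDimensional.span_of_finite E (Set.finite_range v)
  let b : Module.Basis (Fin (rankWeight E v)) E (Submodule.span E (Set.range v)) :=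
    Module.finBasis E _
  have hB : ∀ i, ∃ B : Fin N → E, ∑ u, B u • v u = (b i : F) := fun i =>
    (Submodule.mem_span_range_iff_exists_fun E).1 (b i).2
  choose B hB using hB
  refine ⟨fun i => b i, Matrix.of fun i u => b.repr ⟨v u, hmem u⟩ i,
    Matrix.of fun u i => B i u, ?_, fun u => ?_⟩
  · ext i j
    have h : ∑ u, B j u • (⟨v u, hmem u⟩ : Submodule.span E (Set.range v)) = b j :=
      Subtype.ext (by simpa using hB j)
    have h2 := congrArg (fun y => b.repr y i) h
    simp only [map_sum, map_smul, Finsupp.finsetSum_apply, Finsupp.smul_apply, smul_eq_mul,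
      Module.Basis.repr_self, Finsupp.single_apply] at h2
    rw [Matrix.mul_apply, Matrix.one_apply]
    simp_rw [@eq_comm _ i j, ← h2, Matrix.of_apply, mul_comm]
  · have h := congrArg Subtype.val (b.sum_repr ⟨v u, hmem u⟩)
    refine h.symm.trans ?_
    rw [AddSubmonoidClass.coe_finsetSum]
    rfl

end RankFactorization

section Independence

variable {K L : Type*} [Field K] [Field L] [Algebra K L]

theorem linearIndependent_matrix_smul {w N : Type*} [Fintype w] [Fintype N] [DecidableEq w]
    {A : Matrix w N K} {B : Matrix N w K} (hAB : A * B = 1) {z : N → L}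
    (hz : LinearIndependent K z) : LinearIndependent K fun i => ∑ u, A i u • z u := by
  rw [Fintype.linearIndependent_iff] at hz ⊢
  intro g hg i
  have h : Matrix.vecMul g A = 0 := by
    funext u
    refine hz (Matrix.vecMul g A) ?_ u
    rw [← hg]
    simp only [Matrix.vecMul, dotProduct, Finset.sum_smul, Finset.smul_sum, smul_smul]
    rw [Finset.sum_comm]
  have h2 : Matrix.vecMul (Matrix.vecMul g A) B = g := by
    rw [Matrix.vecMul_vecMul, hAB, Matrix.vecMul_one]
  rw [← h2, h, Matrix.zero_vecMul]
  rfl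

/-- The conjugate vectors of a `K`-independent family span: only the zero vector is orthogonal to
all of them, by nondegeneracy of the trace form. -/
theorem eq_zero_of_forall_sum_mul_conj_eq_zero [FiniteDimensional K L] [IsGalois K L]
    {ι : Type*} [Fintype ι] {y : ι → L} (hy : LinearIndependent K y) {z : ι → L}
    (h : ∀ τ : L ≃ₐ[K] L, ∑ i, z i * τ (y i) = 0) (i : ι) : z i = 0 := by
  have htr : ∀ μ : L, Algebra.trace K L (z i * μ) = 0 := by
    intro μ
    refine Fintype.linearIndependent_iff.1 hy (fun i => Algebra.trace K L (z i * μ)) ?_ i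
    simp_rw [Algebra.smul_def, trace_eq_sum_automorphisms, Finset.sum_mul]
    rw [Finset.sum_comm]
    refine Finset.sum_eq_zero fun τ _ => ?_
    have h1 := congrArg τ (h τ⁻¹)
    rw [map_zero, map_sum] at h1
    calc ∑ i, τ (z i * μ) * y i = τ μ * ∑ i, τ (z i * τ⁻¹ (y i)) := by
          rw [Finset.mul_sum]
          refine Finset.sum_congr rfl fun j _ => ?_
          have : τ (τ⁻¹ (y j)) = y j := τ.apply_symm_apply (y j)
          rw [map_mul, map_mul, this]
          ring
      _ = 0 := by rw [h1, mul_zero]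
  exact (traceForm_nondegenerate K L).1 _ fun μ => htr μ

end Independence

/-! ### Growth of spans under a semilinear map -/

section Growth

variable {L V : Type*} [Field L] [AddCommGroup V] [Module L V]

/-- The span of the vectors `ψ^i (v_j)` with `i < N`. -/
def iterSpan {J : Type*} (ψ : V → V) (v : J → V) (N : ℕ) : Submodule L V :=
  Submodule.span L {x | ∃ i < N, ∃ j, x = (ψ^[i]) (v j)}

/-- If only the whole space contains the `v_j` and is `ψ`-stable, then the spaces `iterSpan ψ v N`
gain a dimension at each step until they fill `V`: a step without gain gives a stable space. -/
theorem min_finrank_le_finrank_iterSpan [FiniteDimensional L V] {σ : L →+* L}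
    (ψ : V →ₛₗ[σ] V) {J : Type*} (v : J → V)
    (hv : ∀ W : Submodule L V, (∀ j, v j ∈ W) → (∀ x ∈ W, ψ x ∈ W) → W = ⊤) (M N : ℕ) :
    min (Module.finrank L V) (Module.finrank L (iterSpan (L := L) ψ v M) + N) ≤
      Module.finrank L (iterSpan (L := L) ψ v (M + N)) := by
  induction N with
  | zero => simp
  | succ N ih =>
    have hle : iterSpan (L := L) ψ v (M + N) ≤ iterSpan ψ v (M + (N + 1)) :=
      Submodule.span_mono fun x ⟨i, hi, j, hx⟩ => ⟨i, by omega, j, hx⟩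
    rcases hle.eq_or_lt with heq | hlt
    · have htop : iterSpan (L := L) ψ v (M + N) = ⊤ := by
        refine hv _ (fun j => ?_) (fun x hx => ?_)
        · rw [heq]
          exact Submodule.subset_span ⟨0, by omega, j, rfl⟩
        · have : iterSpan (L := L) ψ v (M + N) ≤ (iterSpan ψ v (M + (N + 1))).comap ψ := by
            refine Submodule.span_le.2 ?_
            rintro _ ⟨i, hi, j, rfl⟩
            exact Submodule.subset_span
              ⟨i + 1, by omega, j, (Function.iterate_succ_apply' ψ i (v j)).symm⟩
          rw [heq]
          exact this hx
      rw [← heq, htop, finrank_top]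
      exact min_le_left _ _
    · have := Submodule.finrank_lt_finrank_of_lt hlt
      omega

/-- The Roos argument for vectors `P_e`, `e ∈ ℤ`, in a space of dimension at most `δ + r - 1`, with
two semilinear maps such that only the whole space contains some `P_e` and is stable under either;
the first map is the shift `P_e ↦ P_{e+1}`. Then the images of the `P_{k_j}` under the powers `ψ₂^i`
with `i < δ - 1` span: at most `δ - 2` of the vectors `P_e` with `k_0 ≤ e ≤ k_0 + δ + r - 2`, which
span, are missing from the `P_{k_j}`. -/
theorem iterSpan_eq_top_of_roos [FiniteDimensional L V] {σ₁ σ₂ : L →+* L}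
    (ψ₁ : V →ₛₗ[σ₁] V) (ψ₂ : V →ₛₗ[σ₂] V)
    (P : ℤ → V) (hψ₁ : ∀ e, ψ₁ (P e) = P (e + 1))
    (hv₁ : ∀ e, ∀ W : Submodule L V, P e ∈ W → (∀ x ∈ W, ψ₁ x ∈ W) → W = ⊤)
    (hv₂ : ∀ e, ∀ W : Submodule L V, P e ∈ W → (∀ x ∈ W, ψ₂ x ∈ W) → W = ⊤)
    (δ r : ℕ) (k : Fin (r + 1) → ℤ) (hk : StrictMono k)
    (hkr : k (Fin.last r) - k 0 ≤ (δ : ℤ) + r - 2) (hδ : 2 ≤ δ)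
    (hV : Module.finrank L V ≤ δ + r - 1) :
    iterSpan (L := L) ψ₂ (fun j => P (k j)) (δ - 1) = ⊤ := by
  classical
  have hit : ∀ (i : ℕ) (e : ℤ), (ψ₁^[i]) (P e) = P (e + i) := by
    intro i
    induction i with
    | zero => intro e; simp
    | succ i ih => intro e; rw [Function.iterate_succ_apply, hψ₁, ih]; push_cast; ring_nf
  set U := Submodule.span L (Set.range fun j => P (k j)) with hU
  -- the exponents of the window that are missing from the `k_j`
  set T : Finset ℤ := Finset.Ico (k 0) (k 0 + (δ + r - 1 : ℕ)) \ Finset.univ.image k with hT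
  have hTcard : T.card = δ - 2 := by
    rw [hT, Finset.card_sdiff_of_subset, Finset.card_image_of_injective _ hk.injective,
      Int.card_Ico, Finset.card_fin]
    · omega
    · intro e he
      obtain ⟨j, -, rfl⟩ := Finset.mem_image.1 he
      have h1 := hk.monotone (Fin.zero_le j)
      have h2 := hk.monotone (Fin.le_last j)
      rw [Finset.mem_Ico]
      omega
  have hwin : U ⊔ Submodule.span L ((T.image P : Finset V) : Set V) = ⊤ := by
    have h1 := min_finrank_le_finrank_iterSpan (L := L) ψ₁ (fun _ : Unit => P (k 0))
      (fun W hW => hv₁ (k 0) W (hW ())) 0 (δ + r - 1)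
    have h2 : iterSpan (L := L) ψ₁ (fun _ : Unit => P (k 0)) (0 + (δ + r - 1)) = ⊤ :=
      Submodule.eq_top_of_finrank_eq (le_antisymm (Submodule.finrank_le _) (by omega))
    rw [eq_top_iff, ← h2]
    refine Submodule.span_le.2 ?_
    rintro _ ⟨i, hi, -, rfl⟩
    rw [hit]
    by_cases hmem : ∃ j, k j = k 0 + i
    · obtain ⟨j, hj⟩ := hmem
      exact Submodule.mem_sup_left (Submodule.subset_span ⟨j, by simp only [hj]⟩)
    · refine Submodule.mem_sup_right (Submodule.subset_span ?_)
      rw [Finset.mem_coe]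
      refine Finset.mem_image_of_mem P ?_
      rw [hT, Finset.mem_sdiff, Finset.mem_Ico]
      refine ⟨⟨by omega, by omega⟩, fun h => ?_⟩
      obtain ⟨j, -, hj⟩ := Finset.mem_image.1 h
      exact hmem ⟨j, hj⟩
  have hUdim : Module.finrank L V ≤ Module.finrank L U + (δ - 2) := by
    rw [← finrank_top L V, ← hwin]
    refine (Submodule.finrank_add_le_finrank_add_finrank _ _).trans ?_
    have h1 := finrank_span_finset_le_card (R := L) (T.image P)
    have h2 := Finset.card_image_le (s := T) (f := P)
    have h3 : Module.finrank L (Submodule.span L ((T.image P : Finset V) : Set V)) ≤ δ - 2 := by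
      rw [← hTcard]; exact le_trans h1 h2
    omega
  have hU1 : iterSpan (L := L) ψ₂ (fun j => P (k j)) 1 = U := by
    refine congrArg _ (Set.ext fun x => ⟨?_, ?_⟩)
    · rintro ⟨i, hi, j, rfl⟩
      obtain rfl : i = 0 := by omega
      exact ⟨j, rfl⟩
    · rintro ⟨j, rfl⟩
      exact ⟨0, one_pos, j, rfl⟩
  have h1 := min_finrank_le_finrank_iterSpan (L := L) ψ₂ (fun j => P (k j))
    (fun W hW => hv₂ (k 0) W (hW 0)) 1 (δ - 2)
  rw [hU1, show 1 + (δ - 2) = δ - 1 by omega] at h1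
  exact Submodule.eq_top_of_finrank_eq (le_antisymm (Submodule.finrank_le _) (by omega))

end Growth

/-! ### Twisted Galois orbits of a block vector -/

section TwistedOrbit

/-- Shifting by a step prime to `m ℓ` reaches every pair of residues modulo `ℓ` and `m`. -/
theorem exists_nat_mul_add_modEq {m ℓ : ℕ} [NeZero m] [NeZero ℓ] (hcop : Nat.Coprime ℓ m) {s : ℤ}
    (hs : Int.gcd ((m : ℤ) * ℓ) s = 1) (e₀ e₁ e₂ : ℤ) :
    ∃ i : ℕ, (ℓ : ℤ) ∣ e₀ + s * i - e₁ ∧ (m : ℤ) ∣ e₀ + s * i - e₂ := by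
  obtain ⟨p, q, hpq⟩ := Int.isCoprime_iff_gcd_eq_one.2 hs
  obtain ⟨u, v, huv⟩ := Nat.isCoprime_iff_coprime.2 hcop
  have hpos : (m : ℤ) * ℓ ≠ 0 :=
    mul_ne_zero (Nat.cast_ne_zero.2 (NeZero.ne m)) (Nat.cast_ne_zero.2 (NeZero.ne ℓ))
  set i₀ : ℤ := q * (e₂ * u * ℓ + e₁ * v * m - e₀) with hi₀
  have hi : ((i₀ % ((m : ℤ) * ℓ)).toNat : ℤ) = i₀ - (m * ℓ) * (i₀ / (m * ℓ)) := by
    rw [Int.toNat_of_nonneg (Int.emod_nonneg _ hpos), Int.emod_def]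
  refine ⟨(i₀ % ((m : ℤ) * ℓ)).toNat, ?_, ?_⟩
  · rw [hi]
    refine ⟨u * (e₂ - e₁) - m * p * (e₂ * u * ℓ + e₁ * v * m - e₀) - s * m * (i₀ / (m * ℓ)), ?_⟩
    linear_combination s * hi₀ + (e₂ * u * ℓ + e₁ * v * m - e₀) * hpq + e₁ * huv
  · rw [hi]
    refine ⟨v * (e₁ - e₂) - ℓ * p * (e₂ * u * ℓ + e₁ * v * m - e₀) - s * ℓ * (i₀ / (m * ℓ)), ?_⟩
    linear_combination s * hi₀ + (e₂ * u * ℓ + e₁ * v * m - e₀) * hpq + e₂ * huv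

variable {K L : Type*} [Field K] [Field L] [Algebra K L] {ℓ : ℕ} {w : Fin ℓ → ℕ}

/-- The vector with entry `a ^ (t e) σ^e(y_{t,v})` at position `v` of block `t`. -/
def orbitVec (σ : L ≃ₐ[K] L) (a : K) (y : ∀ t, Fin (w t) → L) (e : ℤ) :
    (Σ t, Fin (w t)) → L :=
  fun i => algebraMap K L (a ^ ((i.1 : ℤ) * e)) * (σ ^ e) (y i.1 i.2)

/-- The `σ^s`-semilinear map that multiplies `σ^s` on block `t` by `a ^ (t s)`. -/
def twistedShift (σ : L ≃ₐ[K] L) (a : K) (w : Fin ℓ → ℕ) (s : ℤ) :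
    ((Σ t, Fin (w t)) → L) →ₛₗ[((σ ^ s : L ≃ₐ[K] L) : L →+* L)] ((Σ t, Fin (w t)) → L) where
  toFun x i := algebraMap K L (a ^ ((i.1 : ℤ) * s)) * (σ ^ s) (x i)
  map_add' x x' := by
    funext i
    simp [mul_add]
  map_smul' c x := by
    funext i
    simp [mul_left_comm]

theorem twistedShift_orbitVec (σ : L ≃ₐ[K] L) {a : K} (ha : a ≠ 0) (y : ∀ t, Fin (w t) → L)
    (s e : ℤ) : twistedShift σ a w s (orbitVec σ a y e) = orbitVec σ a y (e + s) := by
  funext i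
  change algebraMap K L (a ^ ((i.1 : ℤ) * s)) *
    (σ ^ s) (algebraMap K L (a ^ ((i.1 : ℤ) * e)) * (σ ^ e) (y i.1 i.2)) = _
  rw [map_mul, AlgEquiv.commutes, ← mul_assoc, ← map_mul, ← zpow_add₀ ha, ← AlgEquiv.mul_apply,
    ← zpow_add, orbitVec, add_comm s e, mul_add, add_comm ((i.1 : ℤ) * s)]

theorem iterate_twistedShift_orbitVec (σ : L ≃ₐ[K] L) {a : K} (ha : a ≠ 0)
    (y : ∀ t, Fin (w t) → L) (s e : ℤ) (i : ℕ) :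
    ((twistedShift σ a w s)^[i]) (orbitVec σ a y e) = orbitVec σ a y (e + s * i) := by
  induction i generalizing e with
  | zero => simp
  | succ i ih =>
    rw [Function.iterate_succ_apply, twistedShift_orbitVec σ ha, ih]
    push_cast
    ring_nf

/-- A functional that kills the whole orbit is zero: by the Chinese remainder theorem the
exponents of `a` and of `σ` vary independently, so the blocks separate by a Vandermonde argument,
and in each block the trace form applies. -/
theorem eq_top_of_orbitVec_mem [FiniteDimensional K L] [IsGalois K L] {m : ℕ} [NeZero m] [NeZero ℓ]
    (hcop : Nat.Coprime ℓ m) {σ : L ≃ₐ[K] L} (hσ : ∀ τ : L ≃ₐ[K] L, ∃ e : ℤ, σ ^ e = τ)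
    (hσm : σ ^ m = 1) {a : K} (ha : IsPrimitiveRoot a ℓ) {y : ∀ t, Fin (w t) → L}
    (hy : ∀ t, LinearIndependent K (y t)) {s : ℤ} (hs : Int.gcd ((m : ℤ) * ℓ) s = 1) (e₀ : ℤ)
    (W : Submodule L ((Σ t, Fin (w t)) → L)) (h₀ : orbitVec σ a y e₀ ∈ W)
    (hW : ∀ x ∈ W, twistedShift σ a w s x ∈ W) : W = ⊤ := by
  have ha0 : a ≠ 0 := ha.ne_zero (NeZero.ne ℓ)
  have hmem : ∀ i : ℕ, orbitVec σ a y (e₀ + s * i) ∈ W := by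
    intro i
    rw [← iterate_twistedShift_orbitVec σ ha0]
    induction i with
    | zero => exact h₀
    | succ i ih => rw [Function.iterate_succ_apply']; exact hW _ ih
  have hmem₂ : ∀ e₁ e₂ : ℤ, (fun i : Σ t, Fin (w t) =>
      algebraMap K L (a ^ ((i.1 : ℤ) * e₁)) * (σ ^ e₂) (y i.1 i.2)) ∈ W := by
    intro e₁ e₂
    obtain ⟨i, ⟨d₁, h₁⟩, ⟨d₂, h₂⟩⟩ := exists_nat_mul_add_modEq hcop hs e₀ e₁ e₂
    convert hmem i using 1
    funext j
    have h3 : a ^ ((j.1 : ℤ) * (e₀ + s * i)) = a ^ ((j.1 : ℤ) * e₁) := by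
      rw [show (j.1 : ℤ) * (e₀ + s * i) = (j.1 : ℤ) * e₁ + ℓ * (j.1 * d₁) by
        linear_combination (j.1 : ℤ) * h₁, zpow_add₀ ha0, zpow_mul a (ℓ : ℤ), zpow_natCast a ℓ,
        ha.pow_eq_one, one_zpow, mul_one]
    have h4 : σ ^ (e₀ + s * i) = σ ^ e₂ := by
      rw [show e₀ + s * i = e₂ + m * d₂ by linear_combination h₂, zpow_add, zpow_mul σ (m : ℤ),
        zpow_natCast, hσm, one_zpow, mul_one]
    rw [orbitVec, h3, h4]
  by_contra hne
  obtain ⟨f, hf0, hfW⟩ := Submodule.exists_le_ker_of_lt_top W (lt_top_iff_ne_top.2 hne)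
  have hf : ∀ x, f x = ∑ i, f (Pi.single i 1) * x i := by
    intro x
    conv_lhs => rw [← Finset.univ_sum_single x]
    rw [map_sum]
    refine Finset.sum_congr rfl fun i _ => ?_
    rw [mul_comm, ← smul_eq_mul, ← map_smul, ← Pi.single_smul, smul_eq_mul, mul_one]
  -- the exponents `0, …, ℓ - 1` of `a` give a Vandermonde system with the distinct nodes `a ^ t`
  have hblock : ∀ (e₂ : ℤ) (t : Fin ℓ),
      ∑ v, f (Pi.single ⟨t, v⟩ 1) * (σ ^ e₂) (y t v) = 0 := by
    intro e₂
    have hinj : Function.Injective fun t : Fin ℓ => algebraMap K L (a ^ (t : ℕ)) := fun t t' h =>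
      Fin.ext (ha.pow_inj t.2 t'.2 ((algebraMap K L).injective h))
    refine congrFun (Matrix.eq_zero_of_forall_pow_sum_mul_pow_eq_zero hinj fun e₁ => ?_)
    have h := LinearMap.mem_ker.1 (hfW (hmem₂ (e₁ : ℕ) e₂))
    rw [hf, Fintype.sum_sigma] at h
    rw [← h]
    refine Finset.sum_congr rfl fun t _ => ?_
    rw [Finset.sum_mul]
    refine Finset.sum_congr rfl fun v _ => ?_
    rw [← map_pow, ← pow_mul, ← Nat.cast_mul, zpow_natCast]
    ring
  refine hf0 (LinearMap.ext fun x => ?_)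
  rw [hf, LinearMap.zero_apply]
  refine Finset.sum_eq_zero fun ⟨t, v⟩ _ => ?_
  rw [eq_zero_of_forall_sum_mul_conj_eq_zero (hy t) (z := fun v => f (Pi.single ⟨t, v⟩ 1))
    (fun τ => ?_) v, zero_mul]
  obtain ⟨e, rfl⟩ := hσ τ
  exact hblock e t

/-- A vector with at most `δ + r - 1` entries that satisfies the Roos parity checks is zero. -/
theorem eq_zero_of_roos_checks [FiniteDimensional K L] [IsGalois K L] {m : ℕ} [NeZero m] [NeZero ℓ]
    (hcop : Nat.Coprime ℓ m) {σ : L ≃ₐ[K] L} (hσ : ∀ τ : L ≃ₐ[K] L, ∃ e : ℤ, σ ^ e = τ)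
    (hσm : σ ^ m = 1) {a : K} (ha : IsPrimitiveRoot a ℓ) {y : ∀ t, Fin (w t) → L}
    (hy : ∀ t, LinearIndependent K (y t)) {s : ℤ} (hs : Int.gcd ((m : ℤ) * ℓ) s = 1)
    (δ r : ℕ) (k : Fin (r + 1) → ℤ) (hk : StrictMono k)
    (hkr : k (Fin.last r) - k 0 ≤ (δ : ℤ) + r - 2) (hδ : 2 ≤ δ) (hw : ∑ t, w t ≤ δ + r - 1)
    {z : (Σ t, Fin (w t)) → L}
    (hz : ∀ i : ℕ, i < δ - 1 → ∀ j, ∑ p, z p * orbitVec σ a y (s * i + k j) p = 0) : z = 0 := by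
  have ha0 : a ≠ 0 := ha.ne_zero (NeZero.ne ℓ)
  have htop := iterSpan_eq_top_of_roos (L := L) (twistedShift σ a w 1) (twistedShift σ a w s)
    (orbitVec σ a y) (fun e => twistedShift_orbitVec σ ha0 y 1 e)
    (eq_top_of_orbitVec_mem hcop hσ hσm ha hy (by simp))
    (eq_top_of_orbitVec_mem hcop hσ hσm ha hy hs) δ r k hk hkr hδ (by simpa using hw)
  let f : ((Σ t, Fin (w t)) → L) →ₗ[L] L := Fintype.linearCombination L z
  have hker : iterSpan (L := L) (twistedShift σ a w s) (fun j => orbitVec σ a y (k j)) (δ - 1) ≤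
      LinearMap.ker f := by
    refine Submodule.span_le.2 ?_
    rintro _ ⟨i, hi, j, rfl⟩
    rw [SetLike.mem_coe, LinearMap.mem_ker, iterate_twistedShift_orbitVec σ ha0, ← hz i hi j,
      add_comm]
    simp [f, Fintype.linearCombination_apply, mul_comm]
  funext p
  have : f (Pi.single p 1) = 0 := (htop ▸ hker) Submodule.mem_top
  simpa [f] using this

end TwistedOrbit

/-! ### The bound -/

section RoosBound

/-- The order of `σ` divides `[L : K]` and is a multiple of the order of its restriction to `F`. -/
theorem orderOf_eq_of_restrict {E L : Type*} [Field E] [Field L] [Algebra E L]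
    (F K : IntermediateField E L) [FiniteDimensional K L] [IsGalois K L] (σ : L ≃ₐ[K] L)
    (θ : F ≃ₐ[E] F) (hθ : ∀ x : F, σ (x : L) = (θ x : L))
    (hord : orderOf θ = Module.finrank K L) : orderOf σ = Module.finrank K L := by
  have hpow : ∀ (j : ℕ) (x : F), (σ ^ j) (x : L) = ((θ ^ j) x : L) := by
    intro j
    induction j with
    | zero => intro x; rfl
    | succ j ih => intro x; rw [pow_succ, pow_succ, AlgEquiv.mul_apply, AlgEquiv.mul_apply, hθ, ih]
  refine Nat.dvd_antisymm ?_ ?_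
  · rw [← IsGalois.card_aut_eq_finrank]
    exact orderOf_dvd_natCard σ
  · rw [← hord]
    refine orderOf_dvd_of_pow_eq_one (AlgEquiv.ext fun x => Subtype.ext ?_)
    rw [← hpow, pow_orderOf_eq_one]
    rfl

end RoosBound

end SumRank

theorem theorem4p5
    {E L : Type*} [Field E] [Field L] [Algebra E L]
    (F K : IntermediateField E L) [FiniteDimensional E F] [FiniteDimensional E K]
    (hinf : F ⊓ K = ⊥) (hsup : F ⊔ K = ⊤)
    (m ℓ : ℕ) [NeZero m] [NeZero ℓ]
    (hFE : Module.finrank E F = m) (hLK : Module.finrank K L = m)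
    [IsGalois K L] [IsCyclic (L ≃ₐ[K] L)]
    (σ : L ≃ₐ[K] L) (θ : F ≃ₐ[E] F) (hθ : ∀ x : F, σ (x : L) = (θ x : L))
    (hord : orderOf θ = m) (hfix : ∀ x : F, θ x = x → x ∈ (algebraMap E F).range)
    (hcop : Nat.Coprime ℓ m)
    (C : Submodule F (Fin ℓ → Fin m → F))
    (hC : SumRank.IsCyclicSkewCyclic (θ : F →+* F) C)
    (a : K) (ha : IsPrimitiveRoot a ℓ)
    (β : L) (hβ : SumRank.IsNormalElement K β)
    (b s : ℤ) (hs : Int.gcd ((m : ℤ) * ℓ) s = 1)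
    (δ r : ℕ) (k : Fin (r + 1) → ℤ) (hk : StrictMono k)
    (hkr : k (Fin.last r) - k 0 ≤ (δ : ℤ) + r - 2)
    (hT : ∀ i : ℕ, (i : ℤ) ≤ (δ : ℤ) - 2 → ∀ j : Fin (r + 1),
      ((a ^ (b + s * i + k j), (σ ^ (s * i + k j)) β) : K × L) ∈
        SumRank.definingSet (θ : F →+* F) (σ : L →+* L) C) :
    ((δ + r : ℕ) : ℕ∞) ≤ SumRank.minDist E C := by
  classical
  have hfd : FiniteDimensional K L :=
    FiniteDimensional.of_finrank_pos (hLK ▸ Nat.pos_of_ne_zero (NeZero.ne m))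
  have hordσ : orderOf σ = m :=
    (SumRank.orderOf_eq_of_restrict F K σ θ hθ (hord.trans hLK.symm)).trans hLK
  have hσm : σ ^ m = 1 := hordσ ▸ pow_orderOf_eq_one σ
  have hσgen : ∀ τ : L ≃ₐ[K] L, ∃ e : ℤ, σ ^ e = τ := by
    intro τ
    have hcard : orderOf σ = Nat.card (L ≃ₐ[K] L) := by
      rw [hordσ, IsGalois.card_aut_eq_finrank, hLK]
    have htop := Subgroup.eq_top_of_card_eq (Subgroup.zpowers σ) (by rw [Nat.card_zpowers, hcard])
    exact Subgroup.mem_zpowers_iff.1 (htop ▸ Subgroup.mem_top τ)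
  have hiter : ∀ (j : ℕ) (x : L), ((σ : L →+* L)^[j]) x = (σ ^ j) x := by
    intro j
    induction j with
    | zero => intro x; rfl
    | succ j ih => intro x; rw [Function.iterate_succ_apply, ih, pow_succ]; rfl
  have ha0 : a ≠ 0 := ha.ne_zero (NeZero.ne ℓ)
  -- `k_0 + r ≤ k_r`, because the `k_j` are strictly increasing integers
  have hδ : 2 ≤ δ := by
    have h : ∀ n (hn : n < r + 1), k 0 + n ≤ k ⟨n, hn⟩ := by
      intro n
      induction n with
      | zero => intro hn; simp
      | succ n ih =>
        intro hn
        have h1 := ih (by omega)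
        have h2 : k ⟨n, by omega⟩ < k ⟨n + 1, hn⟩ := hk (by simp)
        push_cast
        omega
    have := h r (by omega)
    have h' : k ⟨r, by omega⟩ = k (Fin.last r) := rfl
    omega
  rw [SumRank.minDist]
  refine le_iInf₂ fun c hc => le_iInf fun hc0 => ?_
  by_contra hlt
  have hwt : SumRank.sumRankWeight E c < δ + r := by
    rw [not_le] at hlt
    exact_mod_cast hlt
  choose x A B hAB hx using fun t => SumRank.exists_rank_factorization E (c t)
  have hβind : LinearIndependent K fun u : Fin m => (σ ^ (u : ℕ)) β :=
    hβ.1.comp (fun u : Fin m => σ ^ (u : ℕ)) fun u u' h =>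
      Fin.ext (pow_injOn_Iio_orderOf (by rw [hordσ]; exact u.2) (by rw [hordσ]; exact u'.2) h)
  let y : ∀ t, Fin (SumRank.rankWeight E (c t)) → L := fun t v =>
    ∑ u, (A t).map (algebraMap E K) v u • (σ ^ (u : ℕ)) β
  have hy : ∀ t, LinearIndependent K (y t) := fun t =>
    SumRank.linearIndependent_matrix_smul (B := (B t).map (algebraMap E K))
      (by rw [← Matrix.map_mul, hAB t, Matrix.map_one _ (map_zero _) (map_one _)]) hβind
  -- the constant `b` only rescales the blocks, by nonzero factors
  let z : (Σ t, Fin (SumRank.rankWeight E (c t))) → L := fun p =>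
    (x p.1 p.2 : L) * algebraMap K L (a ^ ((p.1 : ℤ) * b))
  have hz : z = 0 := by
    refine SumRank.eq_zero_of_roos_checks hcop hσgen hσm ha hy hs δ r k hk hkr hδ
      (Nat.le_sub_one_of_lt hwt) fun i hi j => ?_
    have hsum := SumRank.sum_eq_zero_of_mem_definingSet (θ : F →+* F) (σ : L →+* L)
      (fun x => (hθ x).symm) (fun x => σ.commutes x) (fun x => by rw [hiter, hσm]; rfl)
      (hT i (by omega) j) hc
    rw [← hsum, Fintype.sum_sigma]
    refine Finset.sum_congr rfl fun t _ => ?_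
    set e := s * (i : ℤ) + k j with he
    have hterm : ∀ u : Fin m, (algebraMap F L) (c t u) *
        (algebraMap K L) (a ^ (b + s * i + k j)) ^ (t : ℕ) * ((σ : L →+* L)^[(u : ℕ)]) ((σ ^ e) β) =
        ∑ v, z ⟨t, v⟩ * (algebraMap K L (a ^ ((t : ℤ) * e)) *
          (algebraMap K L (algebraMap E K (A t v u)) * (σ ^ e) ((σ ^ (u : ℕ)) β))) := by
      intro u
      have h1 : (σ ^ e) ((σ ^ (u : ℕ)) β) = (σ ^ (u : ℕ)) ((σ ^ e) β) := by
        rw [← AlgEquiv.mul_apply, ← AlgEquiv.mul_apply,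
          (((Commute.refl σ).zpow_left e).pow_right u).eq]
      have h2 : (a ^ (b + s * i + k j)) ^ (t : ℕ) = a ^ ((t : ℤ) * b) * a ^ ((t : ℤ) * e) := by
        rw [← zpow_natCast, ← zpow_mul, ← zpow_add₀ ha0, he]
        congr 1
        ring
      rw [hiter, h1, ← map_pow, h2, hx t u, map_sum, Finset.sum_mul, Finset.sum_mul]
      refine Finset.sum_congr rfl fun v _ => ?_
      have h3 : algebraMap F L (A t v u • x t v) =
          algebraMap K L (algebraMap E K (A t v u)) * (x t v : L) := by
        rw [Algebra.smul_def, map_mul]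
        rfl
      rw [h3, map_mul]
      simp only [z]
      ring
    rw [Finset.sum_congr rfl fun u _ => hterm u, Finset.sum_comm]
    refine Finset.sum_congr rfl fun v _ => ?_
    rw [SumRank.orbitVec, ← Finset.mul_sum, ← Finset.mul_sum]
    simp only [y, map_sum, Matrix.map_apply, Algebra.smul_def, map_mul, AlgEquiv.commutes]
  refine hc0 (funext fun t => funext fun u => ?_)
  rw [hx t u]
  refine Finset.sum_eq_zero fun v _ => ?_
  have h1 : (x t v : L) * algebraMap K L (a ^ ((t : ℤ) * b)) = 0 := congrFun hz ⟨t, v⟩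
  have h2 : algebraMap K L (a ^ ((t : ℤ) * b)) ≠ 0 :=
    (map_ne_zero _).2 (zpow_ne_zero _ ha0)
  have h3 : x t v = 0 := Subtype.ext ((mul_eq_zero.1 h1).resolve_right h2)
  rw [h3, smul_zero]
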